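/- Let $A$ be a finite set of alternatives with $|A|\ge 3$, let $\mathbb{P}$ be the set of all linear orders on $A$ (where $a\,P\,b$ means that $a$ is ranked strictly above $b$), and let $\mathbb{D}\subseteq\mathbb{P}$ be a domain. For $P\in\mathbb{P}$ let $r(P,a)$ be the rank of $a$ in $P$ (one plus the number of alternatives ranked strictly above $a$) and let $r_1(P)$ be the alternative of rank $1$. Two orders $P,P'$ are adjacent if there are $a,b\in A$ with $r(P,a)=r(P,b)+1$, $r(P',a)=r(P,b)$, $r(P',b)=r(P,a)$ and $r(P,c)=r(P',c)$ for all $c\in A\setminus\{a,b\}$. A path in $\mathbb{D}$ from $P$ to $P'$ is a finite sequence of distinct elements of $\mathbb{D}$ that starts at $P$ and ends at $P'$ and whose consecutive elements are adjacent; $\mathbb{D}$ is connected if any two of its elements are joined by a path in $\mathbb{D}$. For $P\in\mathbb{D}$ the top-connected closure $\mathbb{D}^{TCC}(P)$ consists of $P$ and of all $P'\in\mathbb{D}$ that can be joined to $P$ by a path in $\mathbb{D}$ all of whose members have the same top alternative. A neighbour of $\bar{\mathbb{D}}\subseteq\mathbb{D}$ in $\mathbb{D}$ is an element of $\mathbb{D}\setminus\bar{\mathbb{D}}$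 that is adjacent to some element of $\bar{\mathbb{D}}$. The domain $\mathbb{D}$ is connected with two distinct neighbours if it is connected and, for every $P\in\mathbb{D}$, the set $\mathbb{D}^{TCC}(P)$ has two neighbours $P',P''$ in $\mathbb{D}$ with $r_1(P')\ne r_1(P'')$. It is minimally rich if for every $a\in A$ there is $P\in\mathbb{D}$ with $r_1(P)=a$. Let $n\ge 2$ be the number of voters. A social choice function $f:\mathbb{D}^n\to A$ is unanimous if $f(P)=a$ whenever $r(P_i,a)=1$ for every voter $i$; it is strategy-proof if there are no voter $i$, profile $P\in\mathbb{D}^n$ and $P_i'\in\mathbb{D}$ with $f(P_i',P_{-i})\,P_i\,f(P_i,P_{-i})$; it is dictatorial if there is a voter $i$ with $f(P)=r_1(P_i)$ for all $P\in\mathbb{D}^n$. Theorem. If $\mathbb{D}$ is minimally rich and connected with two distinct neighbours, then for every $n\ge 2$ every unanimous and strategy-proof social choice function $f:\mathbb{D}^n\to A$ is dictatorial. -/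

import Mathlib

/-- A preference over `A`: a linear order, given by its strict part, so that `P.rel a b`
means that `a` is ranked strictly above `b`. -/
@[ext]
structure Pref (A : Type*) where
  /-- `rel a b`: `a` is strictly preferred to `b`. -/
  rel : A → A → Prop
  irrefl : ∀ a, ¬ rel a a
  trans : ∀ a b c, rel a b → rel b c → rel a c
  total : ∀ a b, a ≠ b → rel a b ∨ rel b a

namespace Pref

/-- The rank of `a` in `P`: one plus the number of alternatives ranked above `a`. -/
noncomputable def rank {A : Type*} (P : Pref A) (a : A) : ℕ :=
  {b : A | P.rel b a}.ncard + 1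

theorem exists_rank_eq_one {A : Type*} [Fintype A] [Nonempty A] (P : Pref A) :
    ∃ a, P.rank a = 1 := by
  have hwf : WellFounded P.rel :=
    @Finite.wellFounded_of_trans_of_irrefl A _ P.rel ⟨P.trans⟩ ⟨P.irrefl⟩
  obtain ⟨a, -, ha⟩ := hwf.has_min (Set.univ : Set A) Set.univ_nonempty
  refine ⟨a, ?_⟩
  have h : {b : A | P.rel b a} = ∅ :=
    Set.eq_empty_iff_forall_notMem.2 fun b hb => ha b (Set.mem_univ b) hb
  simp [rank, h]

/-- The top-ranked alternative `r₁(P)`. -/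
noncomputable def top {A : Type*} [Fintype A] [Nonempty A] (P : Pref A) : A :=
  Classical.choose P.exists_rank_eq_one

theorem rank_top {A : Type*} [Fintype A] [Nonempty A] (P : Pref A) : P.rank P.top = 1 :=
  Classical.choose_spec P.exists_rank_eq_one

/-- `r₁(P) = a` if and only if `r(P, a) = 1`. -/
theorem top_eq_iff {A : Type*} [Fintype A] [Nonempty A] (P : Pref A) (a : A) :
    P.top = a ↔ P.rank a = 1 := by
  have key : ∀ x y, P.rank x = 1 → ¬ P.rel y x := by
    intro x y hx hy
    have h0 : {b : A | P.rel b x}.ncard = 0 := by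
      unfold rank at hx
      omega
    have hempty : {b : A | P.rel b x} = ∅ := (Set.ncard_eq_zero (Set.toFinite _)).1 h0
    have hmem : y ∈ {b : A | P.rel b x} := hy
    rw [hempty] at hmem
    exact hmem
  constructor
  · rintro rfl
    exact P.rank_top
  · intro ha
    by_contra hne
    rcases P.total _ _ hne with h | h
    · exact key a P.top ha h
    · exact key P.top a P.rank_top h

/-- Two preferences are adjacent if they differ by exchanging two alternatives `a`, `b` of
consecutive ranks. -/
def Adjacent {A : Type*} (P Q : Pref A) : Prop :=
  ∃ a b : A, P.rank a = P.rank b + 1 ∧ Q.rank a = P.rank b ∧ Q.rank b = P.rank a ∧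
    ∀ c : A, c ≠ a → c ≠ b → P.rank c = Q.rank c

/-- `l` is a path from `P` to `Q` in the domain `D`: a sequence of distinct preferences of `D`,
starting at `P` and ending at `Q`, whose consecutive members are adjacent. -/
def IsPathIn {A : Type*} (D : Set (Pref A)) (P Q : Pref A) (l : List (Pref A)) : Prop :=
  l.Nodup ∧ (∀ R ∈ l, R ∈ D) ∧ l.IsChain Adjacent ∧ l.head? = some P ∧ l.getLast? = some Q

/-- The domain `D` is connected: any two of its members are joined by a path in `D`. -/
def IsConnectedDomain {A : Type*} (D : Set (Pref A)) : Prop :=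
  ∀ P ∈ D, ∀ Q ∈ D, ∃ l, IsPathIn D P Q l

/-- `P` and `Q` are joined by a path in `D` along which the top alternative is constant. -/
def TopConnected {A : Type*} [Fintype A] [Nonempty A] (D : Set (Pref A)) (P Q : Pref A) : Prop :=
  ∃ l, IsPathIn D P Q l ∧ ∀ R ∈ l, R.top = P.top

/-- The top-connected closure of `P` in `D`. -/
def topConnectedClosure {A : Type*} [Fintype A] [Nonempty A] (D : Set (Pref A)) (P : Pref A) :
    Set (Pref A) :=
  {Q | Q ∈ D ∧ TopConnected D P Q} ∪ {P}

/-- The set `N(E, D)` of neighbours of the sub-domain `E` in `D`. -/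
def neighbours {A : Type*} (E D : Set (Pref A)) : Set (Pref A) :=
  {P | P ∈ D \ E ∧ ∃ Q ∈ E, Adjacent Q P}

/-- The sub-domain `E` has two neighbours in `D` with distinct top alternatives. -/
def HasTwoDistinctNeighbours {A : Type*} [Fintype A] [Nonempty A] (E D : Set (Pref A)) : Prop :=
  ∃ P ∈ neighbours E D, ∃ Q ∈ neighbours E D, P.top ≠ Q.top

/-- The domain `D` is connected with two distinct neighbours. -/
def ConnectedWithTwoDistinctNeighbours {A : Type*} [Fintype A] [Nonempty A]
    (D : Set (Pref A)) : Prop :=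
  IsConnectedDomain D ∧ ∀ P ∈ D, HasTwoDistinctNeighbours (topConnectedClosure D P) D

/-- Every alternative is the top alternative of some preference in `D`. -/
def MinimallyRich {A : Type*} [Fintype A] [Nonempty A] (D : Set (Pref A)) : Prop :=
  ∀ a : A, ∃ P ∈ D, P.top = a

end Pref

/-- A social choice function for `n` voters with common domain `D`. -/
abbrev SCF {A : Type*} (D : Set (Pref A)) (n : ℕ) : Type _ := (Fin n → D) → A

namespace SCF

/-- If all voters rank `a` first, then `a` is chosen. -/
def Unanimous {A : Type*} {D : Set (Pref A)} {n : ℕ} (f : SCF D n) : Prop :=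
  ∀ (a : A) (P : Fin n → D), (∀ i, (P i : Pref A).rank a = 1) → f P = a

/-- Voter `i` can manipulate `f` at the profile `P`. -/
def Manipulable {A : Type*} {D : Set (Pref A)} {n : ℕ} (f : SCF D n) (i : Fin n)
    (P : Fin n → D) : Prop :=
  ∃ Q : D, (P i : Pref A).rel (f (Function.update P i Q)) (f P)

/-- No voter can manipulate `f` at any profile. -/
def StrategyProof {A : Type*} {D : Set (Pref A)} {n : ℕ} (f : SCF D n) : Prop :=
  ∀ (i : Fin n) (P : Fin n → D), ¬ Manipulable f i P

/-- There is a voter whose top alternative is always chosen. -/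
def Dictatorial {A : Type*} [Fintype A] [Nonempty A] {D : Set (Pref A)} {n : ℕ}
    (f : SCF D n) : Prop :=
  ∃ i : Fin n, ∀ P : Fin n → D, f P = (P i : Pref A).top

end SCF

/-! Link two alternatives when two orders of the domain differ only by exchanging them at the top.
Connectedness and minimal richness make this graph on `A` connected, and the two distinct neighbours
give each vertex at least two links. For two voters, let `S a b` mean that top `a` of the first
voter beats top `b` of the second. On a link, one of the two voters prevails (`firstPrevails_or`).
The relation `S` passes from a link to the next one along a non-backtracking walk
(`firstPrevails_turn`) and composes (`firstPrevails_comp`). As `A` is finite, such a walk revisits a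
vertex; this lets `S` reverse direction, spread to all links, and then to all pairs
(`forall_of_propagates`). So one voter dictates. For `n` voters, giving each of two blocks a common
preference yields two-voter rules. Hence a coalition or its complement is decisive, and a decisive
union of two disjoint coalitions has a decisive part; this leads down to one voter. -/

namespace Pref

/-! ### Ranks and the graph of top swaps -/

variable {A : Type*}

theorem asymm (P : Pref A) {a b : A} (h : P.rel a b) : ¬ P.rel b a :=
  fun h' => P.irrefl a (P.trans _ _ _ h h')

theorem eq_or_rel_of_not_rel (P : Pref A) {a b : A} (h : ¬ P.rel b a) : a = b ∨ P.rel a b := by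
  by_cases hab : a = b
  · exact Or.inl hab
  · exact Or.inr ((P.total a b hab).resolve_right h)

section Finite

variable [Fintype A]

theorem rank_lt_of_rel (P : Pref A) {a b : A} (h : P.rel a b) : P.rank a < P.rank b := by
  have hlt : {c : A | P.rel c a}.ncard < {c : A | P.rel c b}.ncard := by
    refine Set.ncard_lt_ncard ⟨fun c hc => P.trans _ _ _ hc h, fun hsub => ?_⟩ (Set.toFinite _)
    exact P.irrefl a (hsub (show P.rel a b from h))
  unfold rank
  omega

theorem rel_iff_rank_lt (P : Pref A) {a b : A} : P.rel a b ↔ P.rank a < P.rank b := by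
  refine ⟨P.rank_lt_of_rel, fun h => ?_⟩
  have hne : a ≠ b := by
    rintro rfl
    exact lt_irrefl _ h
  exact (P.total a b hne).resolve_right fun h' => lt_asymm h (P.rank_lt_of_rel h')

theorem rank_injective (P : Pref A) : Function.Injective P.rank := by
  intro a b h
  by_contra hne
  rcases P.total a b hne with h' | h'
  · exact (P.rank_lt_of_rel h').ne h
  · exact (P.rank_lt_of_rel h').ne' h

variable [Nonempty A]

theorem not_rel_top (P : Pref A) (a : A) : ¬ P.rel a P.top := by
  intro h
  have h1 := P.rank_lt_of_rel h
  rw [P.rank_top] at h1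
  unfold rank at h1
  omega

theorem eq_top_of_not_rel (P : Pref A) {a : A} (h : ¬ P.rel P.top a) : a = P.top := by
  rcases P.eq_or_rel_of_not_rel h with h | h
  · exact h
  · exact absurd h (P.not_rel_top a)

/-- `a` and `b` are the two best alternatives of both `P` and `Q`, which differ exactly in the
order of `a` and `b`. -/
structure SwapsTop (a b : A) (P Q : Pref A) : Prop where
  ne : a ≠ b
  top_left : P.top = a
  top_right : Q.top = b
  second_left : ∀ x, x ≠ a → x ≠ b → P.rel b x
  second_right : ∀ x, x ≠ a → x ≠ b → Q.rel a x
  rel_iff : ∀ x y, x ≠ a → x ≠ b → y ≠ a → y ≠ b → (P.rel x y ↔ Q.rel x y)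

theorem SwapsTop.symm {a b : A} {P Q : Pref A} (h : SwapsTop a b P Q) : SwapsTop b a Q P where
  ne := h.ne.symm
  top_left := h.top_right
  top_right := h.top_left
  second_left := fun x hb ha => h.second_right x ha hb
  second_right := fun x hb ha => h.second_left x ha hb
  rel_iff := fun x y hb ha hb' ha' => (h.rel_iff x y ha hb ha' hb').symm

/-- An exchange of consecutive ranks can change the top only if the ranks are 1 and 2. -/
theorem Adjacent.swapsTop {P Q : Pref A} (h : Adjacent P Q) (hne : P.top ≠ Q.top) :
    SwapsTop P.top Q.top P Q := by
  obtain ⟨b, a, hab, hQb, hQa, hrest⟩ := h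
  have hPt : P.top = a := by
    by_contra hPa
    by_cases hPb : P.top = b
    · have h1 := P.rank_top
      rw [hPb, hab] at h1
      unfold rank at h1
      omega
    · exact hne (((Q.top_eq_iff _).2 ((hrest _ hPb hPa).symm.trans P.rank_top)).symm)
  have h1 : P.rank a = 1 := (P.top_eq_iff a).1 hPt
  have hQt : Q.top = b := (Q.top_eq_iff b).2 (hQb.trans h1)
  have hPb : P.rank b = 2 := by omega
  rw [hPt, hQt]
  have hba : a ≠ b := by
    rintro rfl
    omega
  have hge : ∀ x, x ≠ a → x ≠ b → 2 < P.rank x := by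
    intro x hxa hxb
    have hx0 : 1 ≤ P.rank x := Nat.le_add_left _ _
    have hx1 : P.rank x ≠ 1 := fun h => hxa (P.rank_injective (h.trans h1.symm))
    have hx2 : P.rank x ≠ 2 := fun h => hxb (P.rank_injective (h.trans hPb.symm))
    omega
  refine ⟨hba, hPt, hQt, fun x hxa hxb => ?_, fun x hxa hxb => ?_, fun x y hxa hxb hya hyb => ?_⟩
  · rw [rel_iff_rank_lt, hPb]
    exact hge x hxa hxb
  · rw [rel_iff_rank_lt, hQa, hPb, ← hrest x hxb hxa]
    exact hge x hxa hxb
  · rw [rel_iff_rank_lt, rel_iff_rank_lt, hrest x hxb hxa, hrest y hyb hya]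

/-- Two alternatives are linked in `D` if `D` contains two preferences which differ exactly in
the order of these alternatives, their two best ones. -/
def Linked (D : Set (Pref A)) (a b : A) : Prop :=
  ∃ P Q : D, SwapsTop a b (P : Pref A) (Q : Pref A)

theorem Linked.symm {D : Set (Pref A)} {a b : A} (h : Linked D a b) : Linked D b a := by
  obtain ⟨P, Q, h⟩ := h
  exact ⟨Q, P, h.symm⟩

theorem reflTransGen_linked_of_isChain {D : Set (Pref A)} (l : List (Pref A)) {P Q : Pref A}
    (hD : ∀ R ∈ l, R ∈ D) (hl : l.IsChain Adjacent) (hP : l.head? = some P)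
    (hQ : l.getLast? = some Q) : Relation.ReflTransGen (Linked D) P.top Q.top := by
  induction l generalizing P with
  | nil => simp at hP
  | cons R l ih =>
    obtain rfl : R = P := by simpa using hP
    cases l with
    | nil =>
      obtain rfl : R = Q := by simpa using hQ
      exact Relation.ReflTransGen.refl
    | cons R' l =>
      rw [List.isChain_cons_cons] at hl
      have hstep := ih (fun S hS => hD S (List.mem_cons_of_mem _ hS)) hl.2 rfl
        (by simpa using hQ)
      by_cases heq : R.top = R'.top
      · rwa [heq]
      · exact Relation.ReflTransGen.head
          ⟨⟨R, hD R (by simp)⟩, ⟨R', hD R' (by simp)⟩, hl.1.swapsTop heq⟩ hstep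

theorem top_eq_of_mem_topConnectedClosure {D : Set (Pref A)} {P Q : Pref A}
    (h : Q ∈ topConnectedClosure D P) : Q.top = P.top := by
  rcases h with ⟨-, l, hl, htop⟩ | h
  · exact htop Q (List.mem_of_getLast? hl.2.2.2.2)
  · rw [Set.mem_singleton_iff.1 h]

theorem topConnected_of_adjacent {D : Set (Pref A)} {P Q R : Pref A} (hQ : TopConnected D P Q)
    (hadj : Adjacent Q R) (hR : R ∈ D) (htop : R.top = P.top) : TopConnected D P R := by
  obtain ⟨l, ⟨hnd, hlD, hch, hhd, hlast⟩, hlt⟩ := hQ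
  by_cases hmem : R ∈ l
  · obtain ⟨l₁, l₂, rfl⟩ := List.append_of_mem hmem
    have hpre : (l₁ ++ [R]) <+: (l₁ ++ R :: l₂) := ⟨l₂, by simp⟩
    refine ⟨l₁ ++ [R], ⟨hnd.sublist hpre.sublist, fun S hS => hlD S (hpre.subset hS),
      hch.prefix hpre, ?_, by simp⟩, fun S hS => hlt S (hpre.subset hS)⟩
    rw [← hhd]
    cases l₁ <;> simp
  · have hne : l ≠ [] := by
      rintro rfl
      simp at hhd
    refine ⟨l ++ [R], ⟨?_, ?_, ?_, ?_, by simp⟩, ?_⟩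
    · rw [List.nodup_append]
      refine ⟨hnd, by simp, fun S hS T hT => ?_⟩
      rw [List.mem_singleton.1 hT]
      rintro rfl
      exact hmem hS
    · intro S hS
      rcases List.mem_append.1 hS with hS | hS
      · exact hlD S hS
      · rwa [List.mem_singleton.1 hS]
    · rw [List.isChain_append]
      refine ⟨hch, by simp, fun S hS T hT => ?_⟩
      obtain rfl : Q = S := by simpa [hlast] using hS
      obtain rfl : R = T := by simpa using hT
      exact hadj
    · rw [List.head?_append_of_ne_nil _ hne, hhd]
    · intro S hS
      rcases List.mem_append.1 hS with hS | hS
      · exact hlt S hS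
      · rwa [List.mem_singleton.1 hS]

/-- A neighbour with the same top would already lie in the closure, so the adjacency leading to it
must swap the top. -/
theorem linked_of_mem_neighbours {D : Set (Pref A)} {P R : Pref A} (hP : P ∈ D)
    (hR : R ∈ neighbours (topConnectedClosure D P) D) : Linked D P.top R.top := by
  obtain ⟨⟨hRD, hRn⟩, Q, hQ, hadj⟩ := hR
  have hQt := top_eq_of_mem_topConnectedClosure hQ
  have hQD : Q ∈ D ∧ TopConnected D P Q := by
    rcases hQ with h | h
    · exact h
    · rw [Set.mem_singleton_iff.1 h]
      refine ⟨hP, [P], ⟨by simp, by simpa using hP, by simp, rfl, rfl⟩, by simp⟩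
  have hne : Q.top ≠ R.top := by
    intro h
    exact hRn (Or.inl ⟨hRD, topConnected_of_adjacent hQD.2 hadj hRD (h.symm.trans hQt)⟩)
  rw [← hQt]
  exact ⟨⟨Q, hQD.1⟩, ⟨R, hRD⟩, hadj.swapsTop hne⟩

theorem reflTransGen_linked {D : Set (Pref A)} (hrich : MinimallyRich D)
    (hD : IsConnectedDomain D) (a b : A) : Relation.ReflTransGen (Linked D) a b := by
  obtain ⟨P, hP, rfl⟩ := hrich a
  obtain ⟨Q, hQ, rfl⟩ := hrich b
  obtain ⟨l, -, hlD, hch, hhd, hlast⟩ := hD P hP Q hQ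
  exact reflTransGen_linked_of_isChain l hlD hch hhd hlast

theorem exists_linked_ne {D : Set (Pref A)} (hrich : MinimallyRich D)
    (hD : ConnectedWithTwoDistinctNeighbours D) (a b : A) : ∃ c, Linked D b c ∧ c ≠ a := by
  obtain ⟨P, hP, rfl⟩ := hrich b
  obtain ⟨Q, hQ, R, hR, hne⟩ := hD.2 P hP
  by_cases h : Q.top = a
  · exact ⟨R.top, linked_of_mem_neighbours hP hR, fun h' => hne (h.trans h'.symm)⟩
  · exact ⟨Q.top, linked_of_mem_neighbours hP hQ, h⟩

end Finite

end Pref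

/-! ### Propagation along non-backtracking walks -/

/-- In a connected graph without vertices of degree at most one, a reflexive relation that is
propagated along non-backtracking walks, and that holds for one edge, holds everywhere. -/
theorem forall_of_propagates {V : Type*} [Finite V] {L S : V → V → Prop}
    (hsymm : ∀ a b, L a b → L b a) (hconn : ∀ a b, Relation.ReflTransGen L a b)
    (hdeg : ∀ a b, ∃ c, L b c ∧ c ≠ a) (hrefl : ∀ a, S a a)
    (hturn : ∀ a b c, L a b → S a b → L b c → c ≠ a → S b c)
    (hcomp : ∀ a b d, L a b → S a b → S b d → S a d)
    {a b : V} (hab : L a b) (hS : S a b) (x y : V) : S x y := by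
  choose nxt hnxt hnxt_ne using hdeg
  have hrev : ∀ a b, L a b → S a b → S b a := by
    intro a b hab hS
    -- The state is the current directed edge, so that `nxt` can avoid the vertex just left.
    let w : ℕ → V × V := fun k => (fun p : V × V => (p.2, nxt p.1 p.2))^[k] (a, b)
    let z : ℕ → V := fun k => (w k).1
    have hw : ∀ k, w (k + 1) = ((w k).2, nxt (w k).1 (w k).2) := fun k =>
      Function.iterate_succ_apply' _ _ _
    have hz1 : ∀ k, z (k + 1) = (w k).2 := fun k => by simp only [z, hw]
    have hz2 : ∀ k, z (k + 2) = nxt (z k) (z (k + 1)) := fun k => by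
      rw [hz1 (k + 1), hw, hz1]
    have hedge : ∀ k, L (z k) (z (k + 1)) ∧ S (z k) (z (k + 1)) := by
      intro k
      induction k with
      | zero => exact ⟨hab, hS⟩
      | succ k ih =>
        have hL : L (z (k + 1)) (z (k + 2)) := by
          rw [hz2]
          exact hnxt _ _
        refine ⟨hL, hturn _ _ _ ih.1 ih.2 hL ?_⟩
        rw [show k + 1 + 1 = k + 2 from rfl, hz2]
        exact hnxt_ne _ _
    have hforward : ∀ m i, S (z i) (z (i + m)) := by
      intro m
      induction m with
      | zero => exact fun i => hrefl _
      | succ m ih =>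
        intro i
        have h := ih (i + 1)
        rw [show i + 1 + m = i + (m + 1) by omega] at h
        exact hcomp _ _ _ (hedge i).1 (hedge i).2 h
    have hback : ∀ i, S (z (i + 1)) (z i) → S (z 1) (z 0) := by
      intro i
      induction i with
      | zero => exact id
      | succ i ih =>
        intro h
        refine ih (hturn _ _ _ (hsymm _ _ (hedge (i + 1)).1) h (hsymm _ _ (hedge i).1) ?_)
        rw [show i + 1 + 1 = i + 2 from rfl, hz2]
        exact (hnxt_ne _ _).symm
    -- Going on from `z (i + 1)` to `z j = z i` reverses the edge at `i`; `hback` carries the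
    -- reversal to the start of the walk.
    have hcycle : ∀ i j, i < j → z i = z j → S (z 1) (z 0) := by
      intro i j hij heq
      refine hback i ?_
      rw [heq]
      have h := hforward (j - (i + 1)) (i + 1)
      rwa [show i + 1 + (j - (i + 1)) = j by omega] at h
    obtain ⟨i, j, hne, heq⟩ := Finite.exists_ne_map_eq_of_infinite z
    rcases Nat.lt_or_gt_of_ne hne with h | h
    · exact hcycle i j h heq
    · exact hcycle j i h heq.symm
  have hstar : ∀ u, Relation.ReflTransGen L a u → ∀ v, L u v → S u v := by
    intro u hu
    induction hu with
    | refl =>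
      intro v hv
      by_cases h : v = b
      · rwa [h]
      · exact hturn _ _ _ (hsymm _ _ hab) (hrev _ _ hab hS) hv h
    | tail _ huv ih =>
      rename_i u w _
      intro v hv
      by_cases h : v = u
      · rw [h]
        exact hrev _ _ huv (ih _ huv)
      · exact hturn _ _ _ huv (ih _ huv) hv h
  have hxy := hconn x y
  induction hxy using Relation.ReflTransGen.head_induction_on with
  | refl => exact hrefl y
  | head huv _ ih => exact hcomp _ _ _ huv (hstar _ (hconn a _) _ huv) ih

/-! ### Two voters -/

namespace Pref

variable {A : Type*} [Fintype A] [Nonempty A] {D : Set (Pref A)}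

/-- A unanimous and strategy-proof social choice function for two voters. -/
structure TwoVoterRule (g : D → D → A) : Prop where
  unanimous : ∀ P Q : D, (P : Pref A).top = (Q : Pref A).top → g P Q = (P : Pref A).top
  strategyProof_left : ∀ P P' Q : D, ¬ (P : Pref A).rel (g P' Q) (g P Q)
  strategyProof_right : ∀ P Q Q' : D, ¬ (Q : Pref A).rel (g P Q') (g P Q)

theorem TwoVoterRule.flip {g : D → D → A} (hg : TwoVoterRule g) :
    TwoVoterRule (fun P Q => g Q P) where
  unanimous := fun P Q h => (hg.unanimous Q P h.symm).trans h.symm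
  strategyProof_left := fun P P' Q => hg.strategyProof_right Q P P'
  strategyProof_right := fun P Q Q' => hg.strategyProof_left Q Q' P

/-- Whenever the first voter's top is `a` and the second voter's top is `b`, the outcome is `a`. -/
def FirstPrevails (g : D → D → A) (a b : A) : Prop :=
  ∀ P Q : D, (P : Pref A).top = a → (Q : Pref A).top = b → g P Q = a

namespace TwoVoterRule

variable {g : D → D → A}

theorem eq_top_of_left (hg : TwoVoterRule g) {P P' Q : D} (h : g P' Q = (P : Pref A).top) :
    g P Q = (P : Pref A).top := by
  have h1 := hg.strategyProof_left P P' Q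
  rw [h] at h1
  exact (P : Pref A).eq_top_of_not_rel h1

theorem eq_top_of_right (hg : TwoVoterRule g) {P Q Q' : D} (h : g P Q' = (Q : Pref A).top) :
    g P Q = (Q : Pref A).top :=
  hg.flip.eq_top_of_left h

/-- If voter one can obtain the second best alternative, then the outcome is one of the two best. -/
theorem eq_or_eq_of_swapsTop (hg : TwoVoterRule g) {a b : A} {P P' R Q : D}
    (h : SwapsTop a b (P : Pref A) P') (hR : g R Q = b) : g P Q = a ∨ g P Q = b := by
  by_contra! hne
  have h1 := hg.strategyProof_left P R Q
  rw [hR] at h1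
  exact h1 (h.second_left _ hne.1 hne.2)

/-- Against any `Q` with top `b`, voter one at `P` can secure `b`, so the outcome is `a` or `b`. It
is not `b`, since voter two at `P'` would then report `Q`. -/
theorem firstPrevails_of_eq (hg : TwoVoterRule g) {a b : A} {P P' : D}
    (h : SwapsTop a b (P : Pref A) P') (heq : g P P' = a) : FirstPrevails g a b := by
  intro R Q hR hQ
  have hPQ : g P Q = a := by
    refine (hg.eq_or_eq_of_swapsTop (R := P') h
      ((hg.unanimous P' Q (h.top_right.trans hQ.symm)).trans h.top_right)).resolve_right ?_
    intro hb
    have h1 := hg.eq_top_of_right (Q := P') (hb.trans h.top_right.symm)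
    exact h.ne (heq.symm.trans (h1.trans h.top_right))
  exact (hg.eq_top_of_left (hPQ.trans hR.symm)).trans hR

theorem firstPrevails_or (hg : TwoVoterRule g) {a b : A} (h : Linked D a b) :
    FirstPrevails g a b ∨ FirstPrevails (fun P Q => g Q P) b a := by
  obtain ⟨P, P', h⟩ := h
  rcases hg.eq_or_eq_of_swapsTop (Q := P') (R := P') h
    ((hg.unanimous P' P' rfl).trans h.top_right) with heq | heq
  · exact Or.inl (hg.firstPrevails_of_eq h heq)
  · exact Or.inr (hg.flip.firstPrevails_of_eq h.symm heq)

theorem ne_of_firstPrevails (hg : TwoVoterRule g) {a b : A} {P P' : D}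
    (h : SwapsTop a b (P : Pref A) P') (hS : FirstPrevails g a b) (Q : D) : g P Q ≠ b := by
  intro hb
  have h1 := hg.eq_top_of_right (Q := P') (hb.trans h.top_right.symm)
  exact h.ne ((hS P P' h.top_left h.top_right).symm.trans (h1.trans h.top_right))

theorem firstPrevails_comp (hg : TwoVoterRule g) {a b d : A} (hab : Linked D a b)
    (hS : FirstPrevails g a b) (hS' : FirstPrevails g b d) : FirstPrevails g a d := by
  obtain ⟨P, P', h⟩ := hab
  intro R Q hR hQ
  have hPQ : g P Q = a :=
    (hg.eq_or_eq_of_swapsTop h (hS' P' Q h.top_right hQ)).resolve_right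
      (hg.ne_of_firstPrevails h hS Q)
  exact (hg.eq_top_of_left (hPQ.trans hR.symm)).trans hR

/-- If the outcomes differed, each order would strictly prefer its own; outside `a` and `b` the two
orders agree, and `P'` ranks `b` and `a` first. -/
theorem eq_of_swapsTop (hg : TwoVoterRule g) {a b : A} {P P' Q : D}
    (h : SwapsTop a b (P : Pref A) P') (ha : g P' Q ≠ a) (hb : g P' Q ≠ b) :
    g P Q = g P' Q := by
  by_contra hne
  have h1 := ((P : Pref A).eq_or_rel_of_not_rel (hg.strategyProof_left P P' Q)).resolve_left hne
  have h2 := ((P' : Pref A).eq_or_rel_of_not_rel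
    (hg.strategyProof_left P' P Q)).resolve_left (Ne.symm hne)
  have hxb : g P Q ≠ b := by
    intro hx
    rw [hx, ← h.top_right] at h2
    exact not_rel_top _ _ h2
  have hxa : g P Q ≠ a := by
    intro hx
    rw [hx] at h2
    exact asymm _ h2 (h.second_right _ ha hb)
  exact asymm _ h2 ((h.rel_iff _ _ hxa hxb ha hb).1 h1)

theorem firstPrevails_turn (hg : TwoVoterRule g) {a b c : A} (hab : Linked D a b)
    (hS : FirstPrevails g a b) (hbc : Linked D b c) (hca : c ≠ a) : FirstPrevails g b c := by
  obtain ⟨P, P', h⟩ := hab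
  obtain ⟨R, R', h'⟩ := hbc
  -- If `c` were attainable against `P`, voter two at `R`, with `b` then `c` on top, would get `b`
  -- or `c`; but `a` prevails there.
  have hPc : ∀ Q, g P Q ≠ c := by
    intro Q hQ
    rcases hg.flip.eq_or_eq_of_swapsTop (Q := P) (R := Q) h' hQ with h1 | h1
    · exact hg.ne_of_firstPrevails h hS R h1
    · exact hca (h1.symm.trans (hS P R h.top_left h'.top_left))
  -- As `c` is neither `a` nor `b`, swapping these two cannot make it attainable.
  have hP'c : ∀ Q, g P' Q ≠ c := by
    intro Q hQ
    refine hPc Q ((hg.eq_of_swapsTop h ?_ ?_).trans hQ)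
    · rwa [hQ]
    · rw [hQ]
      exact h'.ne.symm
  have hP'R' : g P' R' = b :=
    (hg.flip.eq_or_eq_of_swapsTop (Q := P') (R := R) h'.symm
      ((hg.unanimous P' R (h.top_right.trans h'.top_left.symm)).trans h.top_right)).resolve_left
      (hP'c R')
  exact hg.firstPrevails_of_eq h'
    ((hg.eq_top_of_left (P := R) (hP'R'.trans h'.top_left.symm)).trans h'.top_left)

theorem forall_firstPrevails (hg : TwoVoterRule g) (hrich : MinimallyRich D)
    (hD : ConnectedWithTwoDistinctNeighbours D) {a b : A} (hab : Linked D a b)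
    (hS : FirstPrevails g a b) (P Q : D) : g P Q = (P : Pref A).top :=
  forall_of_propagates (fun _ _ => Linked.symm) (reflTransGen_linked hrich hD.1)
    (exists_linked_ne hrich hD)
    (fun _ P Q hP hQ => (hg.unanimous P Q (hP.trans hQ.symm)).trans hP)
    (fun _ _ _ => hg.firstPrevails_turn) (fun _ _ _ => hg.firstPrevails_comp)
    hab hS _ _ P Q rfl rfl

theorem dictatorial (hg : TwoVoterRule g) (hrich : MinimallyRich D)
    (hD : ConnectedWithTwoDistinctNeighbours D) :
    (∀ P Q : D, g P Q = (P : Pref A).top) ∨ ∀ P Q : D, g P Q = (Q : Pref A).top := by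
  obtain ⟨a⟩ := ‹Nonempty A›
  obtain ⟨b, hab, -⟩ := exists_linked_ne hrich hD a a
  rcases hg.firstPrevails_or hab with h | h
  · exact Or.inl (hg.forall_firstPrevails hrich hD hab h)
  · exact Or.inr fun P Q => hg.flip.forall_firstPrevails hrich hD hab.symm h Q P

end TwoVoterRule

end Pref

/-! ### From two voters to `n` voters -/

namespace SCF

variable {A : Type*} {D : Set (Pref A)} {n : ℕ} {f : SCF D n}

/-- Voters with a common preference `R` cannot gain by a joint deviation. -/
theorem StrategyProof.coalition (hsp : StrategyProof f) (M : Finset (Fin n)) {R : D}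
    {p q : Fin n → D} (hp : ∀ i ∈ M, p i = R) (hq : ∀ i ∉ M, q i = p i) :
    ¬ (R : Pref A).rel (f q) (f p) := by
  induction M using Finset.induction_on generalizing p with
  | empty =>
    rw [show q = p from funext fun i => hq i (Finset.notMem_empty i)]
    exact Pref.irrefl _ _
  | insert i M hi ih =>
    -- Members deviate one at a time, each from `R`, so no step improves the outcome for `R`.
    have h1 : ¬ (R : Pref A).rel (f (Function.update p i (q i))) (f p) := by
      have h := hsp i p
      rw [Manipulable, hp i (Finset.mem_insert_self _ _)] at h
      exact fun hrel => h ⟨q i, hrel⟩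
    have h2 : ¬ (R : Pref A).rel (f q) (f (Function.update p i (q i))) := by
      refine ih (fun j hj => ?_) (fun j hj => ?_)
      · rw [Function.update_of_ne (ne_of_mem_of_not_mem hj hi)]
        exact hp j (Finset.mem_insert_of_mem hj)
      · by_cases hji : j = i
        · subst hji
          rw [Function.update_self]
        · rw [Function.update_of_ne hji]
          exact hq j (by simp [hji, hj])
    intro h
    rcases (R : Pref A).eq_or_rel_of_not_rel h2 with h3 | h3
    · exact h1 (h3 ▸ h)
    · exact h1 (Pref.trans _ _ _ _ h3 h)

variable [Fintype A] [Nonempty A]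

/-- The outcome `a` is preserved if some voters change to preferences with top `a`. -/
theorem StrategyProof.eq_of_top (hsp : StrategyProof f) (M : Finset (Fin n)) {a : A}
    {p q : Fin n → D} (hp : f p = a) (hM : ∀ i ∈ M, (q i : Pref A).top = a)
    (hq : ∀ i ∉ M, q i = p i) : f q = a := by
  induction M using Finset.induction_on generalizing q with
  | empty => rwa [show q = p from funext fun i => hq i (Finset.notMem_empty i)]
  | insert i M hi ih =>
    have h1 : f (Function.update q i (p i)) = a := by
      refine ih (fun j hj => ?_) (fun j hj => ?_)
      · rw [Function.update_of_ne (ne_of_mem_of_not_mem hj hi)]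
        exact hM j (Finset.mem_insert_of_mem hj)
      · by_cases hji : j = i
        · subst hji
          rw [Function.update_self]
        · rw [Function.update_of_ne hji]
          exact hq j (by simp [hji, hj])
    have htop := hM i (Finset.mem_insert_self _ _)
    rw [← htop]
    refine Pref.eq_top_of_not_rel _ fun hrel => hsp i q ⟨p i, ?_⟩
    rw [h1, ← htop]
    exact hrel

/-- The coalition `M` can enforce any alternative that all its members rank first. -/
def Decisive (f : SCF D n) (M : Finset (Fin n)) : Prop :=
  ∀ (a : A) (p : Fin n → D), (∀ i ∈ M, (p i : Pref A).top = a) → f p = a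

theorem Unanimous.decisive_univ (hun : Unanimous f) : Decisive f Finset.univ := fun a p h =>
  hun a p fun i => ((p i : Pref A).top_eq_iff a).1 (h i (Finset.mem_univ i))

theorem StrategyProof.decisive_of_forall (hsp : StrategyProof f) (hrich : Pref.MinimallyRich D)
    {M : Finset (Fin n)}
    (h : ∀ P Q : D, f (fun i => if i ∈ M then P else Q) = (P : Pref A).top) :
    Decisive f M := by
  intro a p hp
  obtain ⟨P, hP, rfl⟩ := hrich a
  -- Outsiders are made to agree on an order topped by the current outcome, which keeps that outcome
  -- and gives a profile covered by `h`.
  obtain ⟨Q, hQ, hQt⟩ := hrich (f fun i => if i ∈ M then ⟨P, hP⟩ else p i)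
  have h1 : f (fun i => if i ∈ M then ⟨P, hP⟩ else ⟨Q, hQ⟩) =
      f (fun i => if i ∈ M then ⟨P, hP⟩ else p i) :=
    hsp.eq_of_top Mᶜ rfl (fun i hi => by simpa [Finset.mem_compl.1 hi] using hQt)
      (fun i hi => by simp [not_not.1 (mt Finset.mem_compl.2 hi)])
  rw [h] at h1
  exact hsp.eq_of_top M h1.symm hp (fun i hi => by simp [hi])

theorem decisive_or_decisive_compl (hrich : Pref.MinimallyRich D)
    (hD : Pref.ConnectedWithTwoDistinctNeighbours D) (hun : Unanimous f) (hsp : StrategyProof f)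
    (M : Finset (Fin n)) : Decisive f M ∨ Decisive f Mᶜ := by
  have hg : Pref.TwoVoterRule (D := D) (fun P Q => f fun i => if i ∈ M then P else Q) := by
    refine ⟨fun P Q h => hun.decisive_univ _ _ fun i _ => ?_, fun P P' Q => ?_, fun P Q Q' => ?_⟩
    · by_cases hi : i ∈ M <;> simp [hi, h]
    · exact hsp.coalition M (fun i hi => by simp [hi]) (fun i hi => by simp [hi])
    · exact hsp.coalition Mᶜ (fun i hi => by simp [Finset.mem_compl.1 hi])
        (fun i hi => by simp [not_not.1 (mt Finset.mem_compl.2 hi)])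
  rcases hg.dictatorial hrich hD with h | h
  · exact Or.inl (hsp.decisive_of_forall hrich h)
  · refine Or.inr (hsp.decisive_of_forall hrich fun P Q => ?_)
    rw [← h Q P]
    congr 1
    funext i
    by_cases hi : i ∈ M <;> simp [hi]

/-- If neither part is decisive, both complements are. Fixing `R` for the voters outside `X ∪ Y`
leaves a two-voter rule with a dictator, say `X`; when `X` alone departs from `R`, the decisive
complement of `X` still enforces the top of `R`. -/
theorem decisive_left_or_right (hcard : 1 < Fintype.card A) (hrich : Pref.MinimallyRich D)
    (hD : Pref.ConnectedWithTwoDistinctNeighbours D) (hun : Unanimous f) (hsp : StrategyProof f)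
    {X Y : Finset (Fin n)} (hXY : Disjoint X Y) (h : Decisive f (X ∪ Y)) :
    Decisive f X ∨ Decisive f Y := by
  by_contra! hne
  have hX := (decisive_or_decisive_compl hrich hD hun hsp X).resolve_left hne.1
  have hY := (decisive_or_decisive_compl hrich hD hun hsp Y).resolve_left hne.2
  obtain ⟨a, b, hab⟩ := Fintype.one_lt_card_iff.1 hcard
  obtain ⟨P, hP, rfl⟩ := hrich a
  obtain ⟨R, hR, rfl⟩ := hrich b
  have hg : Pref.TwoVoterRule (D := D)
      (fun S T => f fun i => if i ∈ X then S else if i ∈ Y then T else ⟨R, hR⟩) := by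
    refine ⟨fun S T hST => h _ _ fun i hi => ?_, fun S S' T => ?_, fun S T T' => ?_⟩
    · by_cases hiX : i ∈ X
      · simp [hiX]
      · have hiY := (Finset.mem_union.1 hi).resolve_left hiX
        simp [hiX, hiY, hST]
    · exact hsp.coalition X (fun i hi => by simp [hi]) (fun i hi => by simp [hi])
    · exact hsp.coalition Y
        (fun i hi => by simp [hi, Finset.disjoint_right.1 hXY hi])
        (fun i hi => by simp [hi])
  rcases hg.dictatorial hrich hD with hd | hd
  · refine hab ((hd ⟨P, hP⟩ ⟨R, hR⟩).symm.trans (hX _ _ fun i hi => ?_))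
    simp [Finset.mem_compl.1 hi]
  · refine hab ((hd ⟨R, hR⟩ ⟨P, hP⟩).symm.trans (hY _ _ fun i hi => ?_))
    simp [Finset.mem_compl.1 hi]

theorem exists_decisive_singleton (hcard : 1 < Fintype.card A) (hrich : Pref.MinimallyRich D)
    (hD : Pref.ConnectedWithTwoDistinctNeighbours D) (hun : Unanimous f) (hsp : StrategyProof f)
    (M : Finset (Fin n)) (hM : Decisive f M) : ∃ i, Decisive f {i} := by
  induction M using Finset.induction_on with
  | empty =>
    obtain ⟨a, b, hab⟩ := Fintype.one_lt_card_iff.1 hcard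
    obtain ⟨P, hP, -⟩ := hrich a
    exact absurd ((hM a (fun _ => ⟨P, hP⟩) (by simp)).symm.trans (hM b _ (by simp))) hab
  | insert i M hi ih =>
    rw [Finset.insert_eq] at hM
    rcases decisive_left_or_right hcard hrich hD hun hsp
      (Finset.disjoint_singleton_left.2 hi) hM with h | h
    · exact ⟨i, h⟩
    · exact ih h

end SCF

theorem theorem3 {A : Type*} [Fintype A] [Nonempty A] (hA : 3 ≤ Fintype.card A)
    (D : Set (Pref A)) (hrich : Pref.MinimallyRich D)
    (hD : Pref.ConnectedWithTwoDistinctNeighbours D)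
    (n : ℕ) (hn : 2 ≤ n) (f : SCF D n)
    (hunan : SCF.Unanimous f) (hsp : SCF.StrategyProof f) :
    SCF.Dictatorial f := by
  obtain ⟨i, hi⟩ := SCF.exists_decisive_singleton (by omega) hrich hD hunan hsp Finset.univ
    hunan.decisive_univ
  exact ⟨i, fun P => hi _ P fun j hj => by rw [Finset.mem_singleton.1 hj]⟩
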